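/- **Register allocation preserves semantics.** *Languages.* RTL and LTL are control-flow-graph languages with the same instructions: $\mathtt{nop}(l')$, $\mathtt{op}(op,\vec r,r,l')$, $\mathtt{load}(\kappa,mode,\vec r,r,l')$, $\mathtt{store}(\kappa,mode,\vec r,r,l')$, $\mathtt{call}(sig,(r_f\mid id),\vec r,r,l')$, $\mathtt{tailcall}(sig,(r_f\mid id),\vec r)$, $\mathtt{cond}(c,\vec r,l_1,l_2)$, $\mathtt{return}(r\mid\cdot)$, where $l',l_1,l_2$ are labels of successors. A function consists of a signature, parameters, a stack size, an entry label and a finite partial map from labels to instructions (its code). In RTL the operands are pseudo-registers; in LTL they are *locations*: machine registers of the PowerPC, of type $\mathtt{int}$ or $\mathtt{float}$, or stack slots $\mathtt{local}(\tau,\delta)$, $\mathtt{incoming}(\tau,\delta)$, $\mathtt{outgoing}(\tau,\delta)$ of type $\tau\in\{\mathtt{int},\mathtt{float}\}$. Two $\mathtt{incoming}$ slots, or two $\mathtt{outgoing}$ slots, overlap if the word intervals of length 1 ($\mathtt{int}$) or 2 ($\mathtt{float}$) that start at their offsets intersect; otherwise distinct locations do not overlap. Both languages have a small-step semantics over a global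 environment, with regular states $\mathcal S(\Sigma,\cdot,\sigma,l,\cdot,M)$ (call stack, current code $g$ in RTL or current function $F'$ in LTL, stack block, label, register state $R$ or location state $L$, memory), call states $\mathcal C(\Sigma,Fd,\vec v,M)$ and return states $\mathcal R(\Sigma,v,M)$; external calls emit events. They differ in two points. An LTL assignment $L\{\ell\leftarrow v\}$ also sets to $\mathtt{undef}$ every other location that overlaps $\ell$. An LTL call saves in the caller's frame the state $\mathtt{postcall}(L)$, in which temporary and caller-save machine registers are $\mathtt{undef}$. A program is initially in the state $\mathcal C(\varepsilon,Fd,\varepsilon,M_0)$, where $Fd$ is its main function and $M_0$ its initial memory; the final states are $\mathcal R(\varepsilon,\mathtt{int}(n),M)$. We write $P\Downarrow B$ if $P$ has the behavior $B$, where $B$ is: termination with a finite trace and exit code $n$; divergence with a finite or infinite trace; or going wrong with a finite trace. *Translation.* Let $\mathit{infer}$ and $\mathit{color}$ be arbitrary (untrusted) procedures that propose a type assignment and a coloring, and let $N$ be a natural number. An RTL function $F$ is translated as follows; translation fails if one of the first three steps fails. 1. $\mathtt{typecheck}(F)=\Gamma$: the assignment $\Gamma$ of types $\mathtt{int}$ or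 $\mathtt{float}$ to pseudo-registers proposed by $\mathit{infer}$, if it makes the parameters and all instructions of $F$ well typed. 2. $\mathtt{analyze}(F)=A$: the sets $A(l)$ of pseudo-registers live after $l$, computed from empty sets by Kildall's worklist algorithm for the inequations $A(l)\supseteq T(s,A(s))$ for all successors $s$ of $l$, if it ends within $N$ iterations. Here $T(l,X)$, the set of registers live before $l$, is obtained from $X$ by removing the register defined by the instruction at $l$ and then adding the registers that it uses, except that $T(l,X)=X$ if this instruction is an $\mathtt{op}$ or $\mathtt{load}$ whose result is not in $X$; and $T(l,X)=\emptyset$ if $l$ carries no instruction. 3. $\mathtt{regalloc}(F,A,\Gamma)=\Phi$: the map $\Phi$ from pseudo-registers to locations proposed by $\mathit{color}$, if it satisfies: $\Phi(r)\neq\Phi(r')$ for all edges $(r,r')$ and $\Phi(r)\neq r_m$ for all edges $(r,r_m)$ of the interference graph; $\Phi(r)$ has type $\Gamma(r)$ for all $r$; and, for all $r$, $\Phi(r)$ is a $\mathtt{local}$ slot or a non-temporary machine register. The interference graph has an edge between the register $r$ defined by the $\mathtt{op}$, $\mathtt{load}$ or $\mathtt{call}$ at $l$ and each $r'\in A(l)\setminus\{r\}$,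 except for the edge $(r_s,r_d)$ when the instruction is a move from $r_s$ to $r_d$; an edge between each $r'\in A(l)\setminus\{r\}$ and each caller-save machine register if the instruction at $l$ is a $\mathtt{call}$ with result $r$; and an edge between each parameter $p$ and each register of $T(l_0,A(l_0))\setminus\{p\}$, where $l_0$ is the entry label. 4. Every mention of a pseudo-register $r$, in the parameters and in the code, is replaced by $\Phi(r)$, except that a move from $r_s$ to $r_d$ with $\Phi(r_s)=\Phi(r_d)$ (coalescing), and an $\mathtt{op}$ or $\mathtt{load}$ at $l$ whose result is not in $A(l)$ (dead-code elimination), become $\mathtt{nop}$. External functions are unchanged. A program is translated function by function; translation fails if it fails for some function. *Invariant.* The relation $\sim$ between RTL and LTL states is defined by: - $\mathcal S(\Sigma,F.\mathtt{code},\sigma,l,R,M)\sim\mathcal S(\Sigma',F',\sigma,l,L,M)$ if $\Sigma\sim\Sigma'$, $F$ is translated to $F'$ with the results $\Gamma,A,\Phi$ of steps 1–3, and $R(r)=L(\Phi(r))$ for all $r\in T(l,A(l))$; - $\mathcal C(\Sigma,Fd,\vec v,M)\sim\mathcal C(\Sigma',Fd',\vec v,M)$ if $\Sigma\sim\Sigma'$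 and $Fd$ is translated to $Fd'$; - $\mathcal R(\Sigma,v,M)\sim\mathcal R(\Sigma',v,M)$ if $\Sigma\sim\Sigma'$; - $\Sigma\sim\Sigma'$ for call stacks holds frame by frame: frames $(r,F.\mathtt{code},\sigma,l,R)$ and $(\Phi(r),F',\sigma,l,L)$ are related if $F$ is translated to $F'$ with the results $\Gamma,A,\Phi$ and, for every value $v$, $R\{r\leftarrow v\}(r')=L\{\Phi(r)\leftarrow v\}(\Phi(r'))$ for all $r'\in T(l,A(l))$. **Theorem.** For all $N$, $\mathit{infer}$ and $\mathit{color}$, if the RTL program $P$ is successfully translated to the LTL program $P'$, then: 1. (initial states) if $P$ has an initial state, so has $P'$; and $S_1\sim S_2$ for all initial states $S_1$ of $P$ and $S_2$ of $P'$; 2. (final states) if $S_1\sim S_2$ and $S_1$ is final with exit code $n$, then $S_2$ is final with exit code $n$; 3. (lock-step simulation) if $S_1\sim S_2$ and $S_1\xrightarrow{t}S_1'$ in the semantics of $P$, there is $S_2'$ such that $S_2\xrightarrow{t}S_2'$ in the semantics of $P'$ and $S_1'\sim S_2'$; 4. (semantic preservation) for every behavior $B$ that is not a going-wrong behavior, if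 $P\Downarrow B$ then $P'\Downarrow B$. -/

import Mathlib

namespace RegAlloc

/-! ### Types, signatures, values -/

/-- Machine integers, also used as signed byte offsets in pointers. -/
abbrev Word := BitVec 32

abbrev Ident := ℕ

/-- The two register classes: integers or pointers, and floats. -/
inductive Ty
  | int
  | float
  deriving DecidableEq

/-- Function signatures; `res = none` stands for `void`. -/
structure Signature where
  args : List Ty
  res : Option Ty
  deriving DecidableEq

/-- The type of the result value of a call; a `void` result is treated as an integer. -/
def Signature.resTy (s : Signature) : Ty := s.res.getD .int

/-- Values; `Float` is the type of IEEE 754 double precision numbers. -/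
inductive Val
  | int (n : Word)
  | float (f : Float)
  | ptr (b : ℤ) (ofs : Word)
  | undef

/-! ### Float conversions -/

section Floats
open Float.Model

/-- Rounding to a float format; the finite case includes overflow to infinity. -/
def roundTo (spec : Format) (f : UnpackedFloat) : UnpackedFloat :=
  UnpackedFloat.unpack spec (UnpackedFloat.pack spec
    (match f with
      | .finite s m e _ => UnpackedFloat.round spec s m e
      | g => g))

/-- Rounding to single precision. -/
def singleOfFloat (f : Float) : Float :=
  .ofModel (pack (roundTo .binary64 (roundTo .binary32 f.toModel.unpack)))

/-- Truncation to a signed integer, saturating. -/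
def intOfFloat (f : Float) : Word := f.toModel.unpack.toInt32.toBitVec

/-- Truncation to an unsigned integer, saturating. -/
def intuOfFloat (f : Float) : Word := f.toModel.unpack.toUInt32.toBitVec

def floatOfInt (n : Word) : Float :=
  .ofModel (pack (UnpackedFloat.ofInt .binary64 n.toInt))

def floatOfIntu (n : Word) : Float :=
  .ofModel (pack (UnpackedFloat.ofNat .binary64 n.toNat))

end Floats

/-! ### Memory states -/

/-- Memory quantities. -/
inductive Chunk
  | int8signed
  | int8unsigned
  | int16signed
  | int16unsigned
  | int32
  | float32
  | float64

/-- Size in bytes. -/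
def Chunk.size : Chunk → ℕ
  | .int8signed | .int8unsigned => 1
  | .int16signed | .int16unsigned => 2
  | .int32 | .float32 => 4
  | .float64 => 8

def Chunk.ty : Chunk → Ty
  | .float32 | .float64 => .float
  | _ => .int

/-- Truncation or extension of a value as prescribed by a memory quantity. -/
def Chunk.cast : Chunk → Val → Val
  | .int8signed, .int n => .int ((n.setWidth 8).signExtend 32)
  | .int8unsigned, .int n => .int ((n.setWidth 8).setWidth 32)
  | .int16signed, .int n => .int ((n.setWidth 16).signExtend 32)
  | .int16unsigned, .int n => .int ((n.setWidth 16).setWidth 32)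
  | .int32, .int n => .int n
  | .int32, .ptr b o => .ptr b o
  | .float32, .float f => .float (singleOfFloat f)
  | .float64, .float f => .float f
  | _, _ => .undef

/-- What a block records at a byte offset: nothing, the first byte of a value that occupies
`n` bytes, or a further byte of such a value. -/
inductive Content
  | undef
  | datum (n : ℕ) (v : Val)
  | cont

def Content.isCont : Content → Bool
  | .cont => true
  | _ => false

/-- Write `v` over the `n` bytes that start at offset `p`. -/
def writeAt (n : ℕ) (c : ℤ → Content) (p : ℤ) (v : Val) : ℤ → Content :=
  fun x => if x = p then .datum n v else if p < x ∧ x < p + n then .cont else c x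

/-- Read the value that occupies exactly the `n` bytes that start at offset `p`. -/
def readAt (n : ℕ) (c : ℤ → Content) (p : ℤ) : Val :=
  match c p with
  | .datum n' v =>
      if n' = n ∧ (List.range (n - 1)).all (fun i => (c (p + 1 + i)).isCont) then v else .undef
  | _ => .undef

/-- Memory blocks, with bounds `[lo, hi)`. -/
structure Block where
  lo : ℤ
  hi : ℤ
  valid : Bool
  contents : ℤ → Content

structure Mem where
  next : ℤ
  blocks : ℤ → Block

namespace Mem

def empty : Mem where
  next := 1
  blocks := fun _ => ⟨0, 0, false, fun _ => .undef⟩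

/-- Allocation of a fresh block with bounds `[lo, hi)` and given contents. -/
def allocWith (M : Mem) (lo hi : ℤ) (c : ℤ → Content) : ℤ × Mem :=
  (M.next, ⟨M.next + 1, Function.update M.blocks M.next ⟨lo, hi, true, c⟩⟩)

def alloc (M : Mem) (lo hi : ℤ) : ℤ × Mem := M.allocWith lo hi (fun _ => .undef)

def free (M : Mem) (b : ℤ) : Mem :=
  { M with blocks := Function.update M.blocks b { M.blocks b with valid := false } }

/-- Access of kind `κ` at byte offset `δ` of block `b` is possible. -/
def Accessible (M : Mem) (κ : Chunk) (b δ : ℤ) : Prop :=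
  (M.blocks b).valid = true ∧ (M.blocks b).lo ≤ δ ∧ δ + κ.size ≤ (M.blocks b).hi

instance (M : Mem) (κ : Chunk) (b δ : ℤ) : Decidable (M.Accessible κ b δ) := by
  unfold Accessible; infer_instance

def load (M : Mem) (κ : Chunk) (b δ : ℤ) : Option Val :=
  if M.Accessible κ b δ then some (κ.cast (readAt κ.size (M.blocks b).contents δ)) else none

def store (M : Mem) (κ : Chunk) (b δ : ℤ) (v : Val) : Option Mem :=
  if M.Accessible κ b δ then
    some { M with
      blocks := Function.update M.blocks b
        { M.blocks b with contents := writeAt κ.size (M.blocks b).contents δ v } }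
  else none

end Mem

/-! ### Programs and global environments -/

/-- Initialization data for global variables. -/
inductive InitData
  | reserve (n : ℕ)
  | int8 (n : Word)
  | int16 (n : Word)
  | int32 (n : Word)
  | float32 (f : Float)
  | float64 (f : Float)

def InitData.size : InitData → ℕ
  | .reserve n => n
  | .int8 _ => 1
  | .int16 _ => 2
  | .int32 _ => 4
  | .float32 _ => 4
  | .float64 _ => 8

/-- Contents of a block initialized with the given data from offset `p` on. -/
def initContents : ℤ → List InitData → ℤ → Content
  | _, [] => fun _ => .undef
  | p, d :: ds =>
      let c := initContents (p + d.size) ds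
      match d with
      | .reserve _ => c
      | .int8 n => writeAt 1 c p (.int n)
      | .int16 n => writeAt 2 c p (.int n)
      | .int32 n => writeAt 4 c p (.int n)
      | .float32 f => writeAt 4 c p (.float f)
      | .float64 f => writeAt 8 c p (.float f)

/-- External functions. -/
structure ExtFun where
  tag : Ident
  sig : Signature

/-- Function definitions, over a type `F` of internal functions. -/
inductive FunDef (F : Type)
  | internal (f : F)
  | external (e : ExtFun)

structure Program (F : Type) where
  vars : List (Ident × List InitData)
  functs : List (Ident × FunDef F)
  main : Ident

/-- Extension of a partial transformation of internal functions to function definitions. -/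
def FunDef.transf {F₁ F₂ : Type} (tr : F₁ → Option F₂) : FunDef F₁ → Option (FunDef F₂)
  | .internal f => (tr f).map .internal
  | .external e => some (.external e)

/-- Extension of a partial transformation of internal functions to programs. -/
def Program.transf {F₁ F₂ : Type} (tr : F₁ → Option F₂) (P : Program F₁) :
    Option (Program F₂) :=
  (P.functs.mapM fun (d : Ident × FunDef F₁) => (d.2.transf tr).map fun fd => (d.1, fd)).map
    fun fs => ⟨P.vars, fs, P.main⟩

structure GlobalEnv (F : Type) where
  symbol : Ident → Option ℤ
  funct : ℤ → Option (FunDef F)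

/-- The `i`-th function has block `-(i+1)`, the `j`-th global variable has block `j+1`. -/
def Program.globalenv {F : Type} (P : Program F) : GlobalEnv F where
  symbol id :=
    match P.functs.findIdx? (fun d => d.1 == id) with
    | some i => some (-((i : ℤ) + 1))
    | none => (P.vars.findIdx? (fun d => d.1 == id)).map fun j => (j : ℤ) + 1
  funct b := if b < 0 then (P.functs[(-b - 1).toNat]?).map Prod.snd else none

/-- The initial memory state, where the `j`-th global variable has block `j+1`. -/
def Program.initmem {F : Type} (P : Program F) : Mem :=
  P.vars.foldl
    (fun M d => (M.allocWith 0 (d.2.map InitData.size).sum (initContents 0 d.2)).2) Mem.empty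

/-! ### Traces, transition semantics and observable behaviors -/

inductive EventVal
  | int (n : Word)
  | float (f : Float)

def EventVal.ty : EventVal → Ty
  | .int _ => .int
  | .float _ => .float

def EventVal.toVal : EventVal → Val
  | .int n => .int n
  | .float f => .float f

/-- Invocation of an external function: name, arguments, result. -/
structure Event where
  tag : Ident
  args : List EventVal
  res : EventVal

abbrev Trace := List Event

/-- Effect of an external function on arguments `vs`, with trace `t` and result `v`. -/
inductive ExtCall (e : ExtFun) : List Val → Trace → Val → Prop
  | intro (args : List EventVal) (res : EventVal) :
      args.map EventVal.ty = e.sig.args → res.ty = e.sig.resTy →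
      ExtCall e (args.map EventVal.toVal) [⟨e.tag, args, res⟩] res.toVal

/-- Observable behaviors. A value of type `Stream'.Seq Event` is a finite or infinite trace. -/
inductive Behavior
  | converges (t : Trace) (n : Word)
  | diverges (T : Stream'.Seq Event)
  | goeswrong (t : Trace)

def Behavior.Wrong : Behavior → Prop
  | .goeswrong _ => True
  | _ => False

/-- Zero, one or several transitions. -/
inductive Star {S : Type} (step : S → Trace → S → Prop) : S → Trace → S → Prop
  | refl (s : S) : Star step s [] s
  | step {s s' s'' : S} {t t' : Trace} :
      step s t s' → Star step s' t' s'' → Star step s (t ++ t') s''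

/-- Infinitely many transitions: the greatest relation `X` such that `X s T` implies
`s → s'` with trace `t`, `X s' T'` and `T = t.T'`, for some `t`, `s'` and `T'`. -/
def Forever {S : Type} (step : S → Trace → S → Prop) (s : S) (T : Stream'.Seq Event) : Prop :=
  ∃ X : S → Stream'.Seq Event → Prop, X s T ∧
    ∀ s T, X s T → ∃ t s' T', step s t s' ∧ X s' T' ∧ T = (Stream'.Seq.ofList t).append T'

/-- The behaviors of a transition system with given initial and final states. -/
inductive Behaves {S : Type} (step : S → Trace → S → Prop) (initial : S → Prop)
    (final : S → Word → Prop) : Behavior → Prop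
  | converges {s s' : S} {t : Trace} {n : Word} :
      initial s → Star step s t s' → final s' n → Behaves step initial final (.converges t n)
  | diverges {s : S} {T : Stream'.Seq Event} :
      initial s → Forever step s T → Behaves step initial final (.diverges T)
  | goeswrong {s s' : S} {t : Trace} :
      initial s → Star step s t s' → (¬ ∃ t' s'', step s' t' s'') → (∀ n, ¬ final s' n) →
      Behaves step initial final (.goeswrong t)

/-! ### Conditions, operators and addressing modes -/

inductive Comparison
  | eq
  | ne
  | gt
  | ge
  | lt
  | le

/-- Signed comparison. -/
def Comparison.cmp : Comparison → Word → Word → Bool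
  | .eq, a, b => a == b
  | .ne, a, b => !(a == b)
  | .gt, a, b => b.slt a
  | .ge, a, b => b.sle a
  | .lt, a, b => a.slt b
  | .le, a, b => a.sle b

/-- Unsigned comparison. -/
def Comparison.cmpu : Comparison → Word → Word → Bool
  | .eq, a, b => a == b
  | .ne, a, b => !(a == b)
  | .gt, a, b => b.ult a
  | .ge, a, b => b.ule a
  | .lt, a, b => a.ult b
  | .le, a, b => a.ule b

def Comparison.cmpf : Comparison → Float → Float → Bool
  | .eq, a, b => a.beq b
  | .ne, a, b => !(a.beq b)
  | .gt, a, b => b.lt a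
  | .ge, a, b => b.le a
  | .lt, a, b => a.lt b
  | .le, a, b => a.le b

/-- Comparison of a pointer with the null pointer or with a pointer to another block. -/
def Comparison.mismatch : Comparison → Option Bool
  | .eq => some false
  | .ne => some true
  | _ => none

inductive Cond
  | comp (c : Comparison)
  | compimm (c : Comparison) (n : Word)
  | compu (c : Comparison)
  | compuimm (c : Comparison) (n : Word)
  | compf (c : Comparison)

def Cond.argTys : Cond → List Ty
  | .comp _ | .compu _ => [.int, .int]
  | .compimm _ _ | .compuimm _ _ => [.int]
  | .compf _ => [.float, .float]

/-- Signed integer or pointer comparison of two values. -/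
def evalComp (c : Comparison) : Val → Val → Option Bool
  | .int a, .int b => some (c.cmp a b)
  | .ptr b o, .ptr b' o' => if b = b' then some (c.cmp o o') else c.mismatch
  | .ptr _ _, .int n => if n = 0 then c.mismatch else none
  | .int n, .ptr _ _ => if n = 0 then c.mismatch else none
  | _, _ => none

def evalCond : Cond → List Val → Option Bool
  | .comp c, [v, w] => evalComp c v w
  | .compimm c n, [v] => evalComp c v (.int n)
  | .compu c, [.int a, .int b] => some (c.cmpu a b)
  | .compuimm c n, [.int a] => some (c.cmpu a n)
  | .compf c, [.float a, .float b] => some (c.cmpf a b)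
  | _, _ => none

inductive Operation
  | move
  | intconst (n : Word)
  | floatconst (f : Float)
  | addrsymbol (id : Ident) (ofs : Word)
  | addrstack (ofs : Word)
  | cast8s
  | cast8u
  | cast16s
  | cast16u
  | negint
  | notbool
  | add
  | addi (n : Word)
  | sub
  | subi (n : Word)
  | mul
  | muli (n : Word)
  | div
  | divu
  | and
  | andi (n : Word)
  | or
  | ori (n : Word)
  | xor
  | xori (n : Word)
  | nand
  | nor
  | nxor
  | shl
  | shr
  | shri (n : Word)
  | shrxi (n : Word)
  | shru
  | rolm (amount mask : Word)
  | negf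
  | absf
  | addf
  | subf
  | mulf
  | divf
  | muladdf
  | mulsubf
  | singleoffloat
  | intoffloat
  | intuoffloat
  | floatofint
  | floatofintu
  | cmp (c : Cond)

/-- Argument types and result type of an operator. Moves are polymorphic; their entry here is
not used. -/
def Operation.type : Operation → List Ty × Ty
  | .move => ([.int], .int)
  | .intconst _ => ([], .int)
  | .floatconst _ => ([], .float)
  | .addrsymbol _ _ => ([], .int)
  | .addrstack _ => ([], .int)
  | .cast8s | .cast8u | .cast16s | .cast16u | .negint | .notbool => ([.int], .int)
  | .addi _ | .subi _ | .muli _ | .andi _ | .ori _ | .xori _ => ([.int], .int)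
  | .shri _ | .shrxi _ | .rolm _ _ => ([.int], .int)
  | .add | .sub | .mul | .div | .divu | .and | .or | .xor => ([.int, .int], .int)
  | .nand | .nor | .nxor | .shl | .shr | .shru => ([.int, .int], .int)
  | .negf | .absf | .singleoffloat => ([.float], .float)
  | .addf | .subf | .mulf | .divf => ([.float, .float], .float)
  | .muladdf | .mulsubf => ([.float, .float, .float], .float)
  | .intoffloat | .intuoffloat => ([.float], .int)
  | .floatofint | .floatofintu => ([.int], .float)
  | .cmp c => (c.argTys, .int)

/-- Evaluation of an operator, where `σ` is the current stack data block. -/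
def evalOp {F : Type} (G : GlobalEnv F) (σ : ℤ) : Operation → List Val → Option Val
  | .move, [v] => some v
  | .intconst n, [] => some (.int n)
  | .floatconst f, [] => some (.float f)
  | .addrsymbol id ofs, [] => (G.symbol id).map fun b => .ptr b ofs
  | .addrstack ofs, [] => some (.ptr σ ofs)
  | .cast8s, [.int a] => some (.int ((a.setWidth 8).signExtend 32))
  | .cast8u, [.int a] => some (.int ((a.setWidth 8).setWidth 32))
  | .cast16s, [.int a] => some (.int ((a.setWidth 16).signExtend 32))
  | .cast16u, [.int a] => some (.int ((a.setWidth 16).setWidth 32))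
  | .negint, [.int a] => some (.int (-a))
  | .notbool, [.int a] => some (.int (if a = 0 then 1 else 0))
  | .notbool, [.ptr _ _] => some (.int 0)
  | .add, [.int a, .int b] => some (.int (a + b))
  | .add, [.ptr b o, .int n] => some (.ptr b (o + n))
  | .add, [.int n, .ptr b o] => some (.ptr b (o + n))
  | .addi n, [.int a] => some (.int (a + n))
  | .addi n, [.ptr b o] => some (.ptr b (o + n))
  | .sub, [.int a, .int b] => some (.int (a - b))
  | .sub, [.ptr b o, .int n] => some (.ptr b (o - n))
  | .sub, [.ptr b o, .ptr b' o'] => if b = b' then some (.int (o - o')) else none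
  | .subi n, [.int a] => some (.int (n - a))
  | .mul, [.int a, .int b] => some (.int (a * b))
  | .muli n, [.int a] => some (.int (a * n))
  | .div, [.int a, .int b] => if b = 0 then none else some (.int (a.sdiv b))
  | .divu, [.int a, .int b] => if b = 0 then none else some (.int (a.udiv b))
  | .and, [.int a, .int b] => some (.int (a &&& b))
  | .andi n, [.int a] => some (.int (a &&& n))
  | .or, [.int a, .int b] => some (.int (a ||| b))
  | .ori n, [.int a] => some (.int (a ||| n))
  | .xor, [.int a, .int b] => some (.int (a ^^^ b))
  | .xori n, [.int a] => some (.int (a ^^^ n))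
  | .nand, [.int a, .int b] => some (.int (~~~(a &&& b)))
  | .nor, [.int a, .int b] => some (.int (~~~(a ||| b)))
  | .nxor, [.int a, .int b] => some (.int (~~~(a ^^^ b)))
  | .shl, [.int a, .int b] => if b.toNat < 32 then some (.int (a <<< b.toNat)) else none
  | .shr, [.int a, .int b] => if b.toNat < 32 then some (.int (a.sshiftRight b.toNat)) else none
  | .shri n, [.int a] => if n.toNat < 32 then some (.int (a.sshiftRight n.toNat)) else none
  | .shrxi n, [.int a] => if n.toNat < 31 then some (.int (a.sdiv (1 <<< n.toNat))) else none
  | .shru, [.int a, .int b] => if b.toNat < 32 then some (.int (a >>> b.toNat)) else none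
  | .rolm k m, [.int a] => some (.int ((a.rotateLeft k.toNat) &&& m))
  | .negf, [.float a] => some (.float (-a))
  | .absf, [.float a] => some (.float a.abs)
  | .addf, [.float a, .float b] => some (.float (a + b))
  | .subf, [.float a, .float b] => some (.float (a - b))
  | .mulf, [.float a, .float b] => some (.float (a * b))
  | .divf, [.float a, .float b] => some (.float (a / b))
  | .muladdf, [.float a, .float b, .float c] => some (.float (a * b + c))
  | .mulsubf, [.float a, .float b, .float c] => some (.float (a * b - c))
  | .singleoffloat, [.float a] => some (.float (singleOfFloat a))
  | .intoffloat, [.float a] => some (.int (intOfFloat a))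
  | .intuoffloat, [.float a] => some (.int (intuOfFloat a))
  | .floatofint, [.int a] => some (.float (floatOfInt a))
  | .floatofintu, [.int a] => some (.float (floatOfIntu a))
  | .cmp c, vs => (evalCond c vs).map fun b => .int (if b then 1 else 0)
  | _, _ => none

inductive Mode
  | indexed (n : Word)
  | indexed2
  | global (id : Ident) (ofs : Word)
  | based (id : Ident) (ofs : Word)
  | stack (ofs : Word)

def Mode.argTys : Mode → List Ty
  | .indexed _ => [.int]
  | .indexed2 => [.int, .int]
  | .global _ _ => []
  | .based _ _ => [.int]
  | .stack _ => []

def evalMode {F : Type} (G : GlobalEnv F) (σ : ℤ) : Mode → List Val → Option Val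
  | .indexed n, [.ptr b o] => some (.ptr b (o + n))
  | .indexed2, [.ptr b o, .int n] => some (.ptr b (o + n))
  | .indexed2, [.int n, .ptr b o] => some (.ptr b (o + n))
  | .global id ofs, [] => (G.symbol id).map fun b => .ptr b ofs
  | .based id ofs, [.int n] => (G.symbol id).map fun b => .ptr b (ofs + n)
  | .stack ofs, [] => some (.ptr σ ofs)
  | _, _ => none

/-! ### Control-flow graphs

Instructions are parameterized by the type `ρ` of the registers that they operate on:
pseudo-registers in RTL, locations in LTL. -/

abbrev Label := ℕ

/-- The function called: its address is in a register, or it is given by its name. -/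
inductive Callee (ρ : Type)
  | reg (r : ρ)
  | sym (id : Ident)

def Callee.map {ρ ρ' : Type} (f : ρ → ρ') : Callee ρ → Callee ρ'
  | .reg r => .reg (f r)
  | .sym id => .sym id

def Callee.regs {ρ : Type} : Callee ρ → List ρ
  | .reg r => [r]
  | .sym _ => []

inductive Instr (ρ : Type)
  | nop (l : Label)
  | op (o : Operation) (args : List ρ) (r : ρ) (l : Label)
  | load (κ : Chunk) (m : Mode) (args : List ρ) (r : ρ) (l : Label)
  | store (κ : Chunk) (m : Mode) (args : List ρ) (r : ρ) (l : Label)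
  | call (sig : Signature) (f : Callee ρ) (args : List ρ) (r : ρ) (l : Label)
  | tailcall (sig : Signature) (f : Callee ρ) (args : List ρ)
  | cond (c : Cond) (args : List ρ) (ltrue lfalse : Label)
  | ret (r : Option ρ)

namespace Instr

def successors {ρ : Type} : Instr ρ → List Label
  | .nop l | .op _ _ _ l | .load _ _ _ _ l | .store _ _ _ _ l | .call _ _ _ _ l => [l]
  | .cond _ _ l l' => [l, l']
  | .tailcall _ _ _ | .ret _ => []

/-- Replace every mention of `r` by `f r`. -/
def map {ρ ρ' : Type} (f : ρ → ρ') : Instr ρ → Instr ρ'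
  | .nop l => .nop l
  | .op o args r l => .op o (args.map f) (f r) l
  | .load κ m args r l => .load κ m (args.map f) (f r) l
  | .store κ m args r l => .store κ m (args.map f) (f r) l
  | .call sig c args r l => .call sig (c.map f) (args.map f) (f r) l
  | .tailcall sig c args => .tailcall sig (c.map f) (args.map f)
  | .cond c args l l' => .cond c (args.map f) l l'
  | .ret r => .ret (r.map f)

end Instr

/-- Finite maps from labels to instructions. -/
structure CFG (ρ : Type) where
  get : Label → Option (Instr ρ)
  nodes : Finset Label
  mem_nodes : ∀ l, l ∈ nodes ↔ (get l).isSome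

/-- Per-node rewriting of a control-flow graph. -/
def CFG.rewrite {ρ ρ' : Type} (g : CFG ρ) (f : Label → Instr ρ → Instr ρ') : CFG ρ' where
  get l := (g.get l).map (f l)
  nodes := g.nodes
  mem_nodes l := by rw [g.mem_nodes]; simp

structure Fn (ρ : Type) where
  sig : Signature
  params : List ρ
  stacksize : ℤ
  entry : Label
  code : CFG ρ

def FunDef.sig {ρ : Type} : FunDef (Fn ρ) → Signature
  | .internal f => f.sig
  | .external e => e.sig

/-- The function that a `call` or `tailcall` invokes, where `R` gives the values of registers. -/
def resolve {ρ : Type} (G : GlobalEnv (Fn ρ)) (R : ρ → Val) : Callee ρ → Option (FunDef (Fn ρ))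
  | .reg r =>
      match R r with
      | .ptr b ofs => if ofs = 0 then G.funct b else none
      | _ => none
  | .sym id => (G.symbol id).bind G.funct

/-! ### RTL -/

/-- Pseudo-registers. -/
abbrev Reg := ℕ

namespace RTL

abbrev Regs := Reg → Val

/-- The register state `[params ↦ vs]`; other registers are undefined. -/
def initRegs : List Reg → List Val → Regs
  | r :: rs, v :: vs => Function.update (initRegs rs vs) r v
  | _, _ => fun _ => .undef

structure Frame where
  res : Reg
  code : CFG Reg
  sp : ℤ
  pc : Label
  regs : Regs

inductive State
  | regular (stk : List Frame) (g : CFG Reg) (σ : ℤ) (l : Label) (R : Regs) (M : Mem)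
  | call (stk : List Frame) (fd : FunDef (Fn Reg)) (vs : List Val) (M : Mem)
  | ret (stk : List Frame) (v : Val) (M : Mem)

inductive Step (G : GlobalEnv (Fn Reg)) : State → Trace → State → Prop
  | nop {stk g σ l R M l'} :
      g.get l = some (.nop l') →
      Step G (.regular stk g σ l R M) [] (.regular stk g σ l' R M)
  | op {stk g σ l R M o args r l' v} :
      g.get l = some (.op o args r l') →
      evalOp G σ o (args.map R) = some v →
      Step G (.regular stk g σ l R M) [] (.regular stk g σ l' (Function.update R r v) M)
  | load {stk g σ l R M κ m args r l' b ofs v} :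
      g.get l = some (.load κ m args r l') →
      evalMode G σ m (args.map R) = some (.ptr b ofs) →
      M.load κ b ofs.toInt = some v →
      Step G (.regular stk g σ l R M) [] (.regular stk g σ l' (Function.update R r v) M)
  | store {stk g σ l R M κ m args r l' b ofs M'} :
      g.get l = some (.store κ m args r l') →
      evalMode G σ m (args.map R) = some (.ptr b ofs) →
      M.store κ b ofs.toInt (R r) = some M' →
      Step G (.regular stk g σ l R M) [] (.regular stk g σ l' R M')
  | call {stk g σ l R M sig c args r l' fd} :
      g.get l = some (.call sig c args r l') →
      resolve G R c = some fd → fd.sig = sig →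
      Step G (.regular stk g σ l R M) [] (.call (⟨r, g, σ, l', R⟩ :: stk) fd (args.map R) M)
  | tailcall {stk g σ l R M sig c args fd} :
      g.get l = some (.tailcall sig c args) →
      resolve G R c = some fd → fd.sig = sig →
      Step G (.regular stk g σ l R M) [] (.call stk fd (args.map R) (M.free σ))
  | condTrue {stk g σ l R M c args l₁ l₂} :
      g.get l = some (.cond c args l₁ l₂) →
      evalCond c (args.map R) = some true →
      Step G (.regular stk g σ l R M) [] (.regular stk g σ l₁ R M)
  | condFalse {stk g σ l R M c args l₁ l₂} :
      g.get l = some (.cond c args l₁ l₂) →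
      evalCond c (args.map R) = some false →
      Step G (.regular stk g σ l R M) [] (.regular stk g σ l₂ R M)
  | retVoid {stk g σ l R M} :
      g.get l = some (.ret none) →
      Step G (.regular stk g σ l R M) [] (.ret stk .undef (M.free σ))
  | retVal {stk g σ l R M r} :
      g.get l = some (.ret (some r)) →
      Step G (.regular stk g σ l R M) [] (.ret stk (R r) (M.free σ))
  | entry {stk f vs M σ M'} :
      M.alloc 0 f.stacksize = (σ, M') →
      Step G (.call stk (.internal f) vs M) []
        (.regular stk f.code σ f.entry (initRegs f.params vs) M')
  | external {stk e vs M t v} :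
      ExtCall e vs t v → Step G (.call stk (.external e) vs M) t (.ret stk v M)
  | resume {stk r g σ l R v M} :
      Step G (.ret (⟨r, g, σ, l, R⟩ :: stk) v M) []
        (.regular stk g σ l (Function.update R r v) M)

inductive Initial (P : Program (Fn Reg)) : State → Prop
  | intro {b fd} :
      P.globalenv.symbol P.main = some b → P.globalenv.funct b = some fd →
      Initial P (.call [] fd [] P.initmem)

inductive Final : State → Word → Prop
  | intro {n M} : Final (.ret [] (.int n) M) n

/-- `P ⇓ B`. -/
def ProgBehaves (P : Program (Fn Reg)) (B : Behavior) : Prop :=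
  Behaves (Step P.globalenv) (Initial P) Final B

end RTL

/-! ### Locations -/

/-- Machine registers that are available to compiled code. -/
inductive MReg
  | R3 | R4 | R5 | R6 | R7 | R8 | R9 | R10 | R11 | R12 | R13 | R14 | R15 | R16 | R17
  | R18 | R19 | R20 | R21 | R22 | R23 | R24 | R25 | R26 | R27 | R28 | R29 | R30 | R31
  | F0 | F1 | F2 | F3 | F4 | F5 | F6 | F7 | F8 | F9 | F10 | F11 | F12 | F14 | F15 | F16
  | F17 | F18 | F19 | F20 | F21 | F22 | F23 | F24 | F25 | F26 | F27 | F28 | F29 | F30 | F31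
  deriving DecidableEq

def MReg.ty : MReg → Ty
  | .R3 | .R4 | .R5 | .R6 | .R7 | .R8 | .R9 | .R10 | .R11 | .R12 | .R13 | .R14 | .R15 | .R16
  | .R17 | .R18 | .R19 | .R20 | .R21 | .R22 | .R23 | .R24 | .R25 | .R26 | .R27 | .R28 | .R29
  | .R30 | .R31 => .int
  | _ => .float

/-- The two integer and three float registers reserved for spilling and reloading. -/
def MReg.temporary : MReg → Bool
  | .R11 | .R12 | .F0 | .F11 | .F12 => true
  | _ => false

/-- The caller-save registers: non-temporary registers that a call does not preserve. -/
def callerSave : Finset MReg :=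
  {.R3, .R4, .R5, .R6, .R7, .R8, .R9, .R10, .F1, .F2, .F3, .F4, .F5, .F6, .F7, .F8, .F9, .F10}

inductive Slot
  | local (τ : Ty) (δ : ℤ)
  | incoming (τ : Ty) (δ : ℤ)
  | outgoing (τ : Ty) (δ : ℤ)
  deriving DecidableEq

inductive Loc
  | reg (m : MReg)
  | slot (s : Slot)
  deriving DecidableEq

def Loc.ty : Loc → Ty
  | .reg m => m.ty
  | .slot (.local τ _) | .slot (.incoming τ _) | .slot (.outgoing τ _) => τ

/-- Size of a stack slot in words. -/
def Ty.words : Ty → ℤ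
  | .int => 1
  | .float => 2

/-- Do two locations have a part in common? The `incoming` and `outgoing` areas mix integers
and floats and are addressed by words. Local integers and local floats have separate areas, each
of them an array indexed by slot number, so that distinct local slots never overlap. -/
def Loc.overlap : Loc → Loc → Bool
  | .reg m, .reg m' => m = m'
  | .slot (.local τ δ), .slot (.local τ' δ') => τ = τ' ∧ δ = δ'
  | .slot (.incoming τ δ), .slot (.incoming τ' δ') => δ < δ' + τ'.words ∧ δ' < δ + τ.words
  | .slot (.outgoing τ δ), .slot (.outgoing τ' δ') => δ < δ' + τ'.words ∧ δ' < δ + τ.words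
  | _, _ => false

/-! ### LTL -/

namespace LTL

abbrev LocMap := Loc → Val

/-- Overlap-aware update. -/
def set (L : LocMap) (ℓ : Loc) (v : Val) : LocMap :=
  fun ℓ' => if ℓ = ℓ' then v else if ℓ.overlap ℓ' then .undef else L ℓ'

/-- The location state `[params ↦ vs]`; other locations are undefined. -/
def initLocs : List Loc → List Val → LocMap
  | ℓ :: ℓs, v :: vs => set (initLocs ℓs vs) ℓ v
  | _, _ => fun _ => .undef

/-- Temporary and caller-save registers lose their values in a call. -/
def postcall (L : LocMap) : LocMap
  | .reg m => if m.temporary = true ∨ m ∈ callerSave then .undef else L (.reg m)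
  | .slot s => L (.slot s)

structure Frame where
  res : Loc
  fn : Fn Loc
  sp : ℤ
  pc : Label
  locs : LocMap

inductive State
  | regular (stk : List Frame) (f : Fn Loc) (σ : ℤ) (l : Label) (L : LocMap) (M : Mem)
  | call (stk : List Frame) (fd : FunDef (Fn Loc)) (vs : List Val) (M : Mem)
  | ret (stk : List Frame) (v : Val) (M : Mem)

inductive Step (G : GlobalEnv (Fn Loc)) : State → Trace → State → Prop
  | nop {stk f σ l L M l'} :
      f.code.get l = some (.nop l') →
      Step G (.regular stk f σ l L M) [] (.regular stk f σ l' L M)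
  | op {stk f σ l L M o args r l' v} :
      f.code.get l = some (.op o args r l') →
      evalOp G σ o (args.map L) = some v →
      Step G (.regular stk f σ l L M) [] (.regular stk f σ l' (set L r v) M)
  | load {stk f σ l L M κ m args r l' b ofs v} :
      f.code.get l = some (.load κ m args r l') →
      evalMode G σ m (args.map L) = some (.ptr b ofs) →
      M.load κ b ofs.toInt = some v →
      Step G (.regular stk f σ l L M) [] (.regular stk f σ l' (set L r v) M)
  | store {stk f σ l L M κ m args r l' b ofs M'} :
      f.code.get l = some (.store κ m args r l') →
      evalMode G σ m (args.map L) = some (.ptr b ofs) →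
      M.store κ b ofs.toInt (L r) = some M' →
      Step G (.regular stk f σ l L M) [] (.regular stk f σ l' L M')
  | call {stk f σ l L M sig c args r l' fd} :
      f.code.get l = some (.call sig c args r l') →
      resolve G L c = some fd → fd.sig = sig →
      Step G (.regular stk f σ l L M) []
        (.call (⟨r, f, σ, l', postcall L⟩ :: stk) fd (args.map L) M)
  | tailcall {stk f σ l L M sig c args fd} :
      f.code.get l = some (.tailcall sig c args) →
      resolve G L c = some fd → fd.sig = sig →
      Step G (.regular stk f σ l L M) [] (.call stk fd (args.map L) (M.free σ))
  | condTrue {stk f σ l L M c args l₁ l₂} :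
      f.code.get l = some (.cond c args l₁ l₂) →
      evalCond c (args.map L) = some true →
      Step G (.regular stk f σ l L M) [] (.regular stk f σ l₁ L M)
  | condFalse {stk f σ l L M c args l₁ l₂} :
      f.code.get l = some (.cond c args l₁ l₂) →
      evalCond c (args.map L) = some false →
      Step G (.regular stk f σ l L M) [] (.regular stk f σ l₂ L M)
  | retVoid {stk f σ l L M} :
      f.code.get l = some (.ret none) →
      Step G (.regular stk f σ l L M) [] (.ret stk .undef (M.free σ))
  | retVal {stk f σ l L M r} :
      f.code.get l = some (.ret (some r)) →
      Step G (.regular stk f σ l L M) [] (.ret stk (L r) (M.free σ))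
  | entry {stk f vs M σ M'} :
      M.alloc 0 f.stacksize = (σ, M') →
      Step G (.call stk (.internal f) vs M) []
        (.regular stk f σ f.entry (initLocs f.params vs) M')
  | external {stk e vs M t v} :
      ExtCall e vs t v → Step G (.call stk (.external e) vs M) t (.ret stk v M)
  | resume {stk r f σ l L v M} :
      Step G (.ret (⟨r, f, σ, l, L⟩ :: stk) v M) [] (.regular stk f σ l (set L r v) M)

inductive Initial (P : Program (Fn Loc)) : State → Prop
  | intro {b fd} :
      P.globalenv.symbol P.main = some b → P.globalenv.funct b = some fd →
      Initial P (.call [] fd [] P.initmem)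

inductive Final : State → Word → Prop
  | intro {n M} : Final (.ret [] (.int n) M) n

/-- `P ⇓ B`. -/
def ProgBehaves (P : Program (Fn Loc)) (B : Behavior) : Prop :=
  Behaves (Step P.globalenv) (Initial P) Final B

end LTL

/-! ### Type reconstruction for RTL -/

/-- Typing of the callee: a register that holds a function address is an integer register. -/
def Callee.WellTyped (Γ : Reg → Ty) : Callee Reg → Prop
  | .reg r => Γ r = .int
  | .sym _ => True

/-- Typing of an instruction in a function with signature `s`. -/
def Instr.WellTyped (s : Signature) (Γ : Reg → Ty) : Instr Reg → Prop
  | .nop _ => True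
  | .op .move args r _ => args.map Γ = [Γ r]
  | .op o args r _ => (args.map Γ, Γ r) = o.type
  | .load κ m args r _ => args.map Γ = m.argTys ∧ Γ r = κ.ty
  | .store κ m args r _ => args.map Γ = m.argTys ∧ Γ r = κ.ty
  | .call sig c args r _ => c.WellTyped Γ ∧ args.map Γ = sig.args ∧ Γ r = sig.resTy
  | .tailcall sig c args => c.WellTyped Γ ∧ args.map Γ = sig.args ∧ sig.res = s.res
  | .cond c args _ _ => args.map Γ = c.argTys
  | .ret r => r.map Γ = s.res

def Fn.WellTyped (f : Fn Reg) (Γ : Reg → Ty) : Prop :=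
  f.params.map Γ = f.sig.args ∧ ∀ l i, f.code.get l = some i → i.WellTyped f.sig Γ

open Classical in
/-- The type assignment computed by the untrusted procedure `infer`, after verification. -/
noncomputable def typecheck (infer : Fn Reg → Reg → Ty) (f : Fn Reg) : Option (Reg → Ty) :=
  if f.WellTyped (infer f) then some (infer f) else none

/-! ### Liveness analysis -/

/-- State of the worklist algorithm: the current approximation and the nodes still to visit. -/
structure Worklist (α : Type) where
  approx : Label → α
  todo : Finset Label

/-- One iteration: take a node `n` off the worklist, propagate `T n (approx n)` to its
predecessors, and put those predecessors whose approximation has changed on the worklist. -/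
def Worklist.step {α : Type} [SemilatticeSup α] [DecidableEq α] (nodes : Finset Label)
    (succs : Label → List Label) (T : Label → α → α) (s : Worklist α) (n : Label) : Worklist α :=
  let out := T n (s.approx n)
  let changed := nodes.filter fun p => n ∈ succs p ∧ s.approx p ⊔ out ≠ s.approx p
  ⟨fun p => if p ∈ changed then s.approx p ⊔ out else s.approx p, s.todo.erase n ∪ changed⟩

/-- At most `k` iterations, with failure if the worklist has not been emptied by then. -/
def Worklist.run {α : Type} [SemilatticeSup α] [DecidableEq α] (nodes : Finset Label)
    (succs : Label → List Label) (T : Label → α → α) : ℕ → Worklist α → Option (Label → α)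
  | k, s =>
      if h : s.todo.Nonempty then
        match k with
        | 0 => none
        | k + 1 => Worklist.run nodes succs T k (s.step nodes succs T (s.todo.min' h))
      else some s.approx

/-- Kildall's algorithm for the backward dataflow inequations
`A l ≥ T s (A s)` for all successors `s` of `l`, with at most `N` iterations. -/
def kildall {α : Type} [SemilatticeSup α] [OrderBot α] [DecidableEq α] (nodes : Finset Label)
    (succs : Label → List Label) (T : Label → α → α) (N : ℕ) : Option (Label → α) :=
  Worklist.run nodes succs T N ⟨fun _ => ⊥, nodes⟩

/-- Registers live before an instruction, given the registers `A` live after it. -/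
def Instr.liveBefore (A : Finset Reg) : Instr Reg → Finset Reg
  | .nop _ => A
  | .op _ args r _ => if r ∈ A then A.erase r ∪ args.toFinset else A
  | .load _ _ args r _ => if r ∈ A then A.erase r ∪ args.toFinset else A
  | .store _ _ args r _ => A ∪ args.toFinset ∪ {r}
  | .call _ c args r _ => A.erase r ∪ args.toFinset ∪ c.regs.toFinset
  | .tailcall _ c args => A ∪ args.toFinset ∪ c.regs.toFinset
  | .cond _ args _ _ => A ∪ args.toFinset
  | .ret r => A ∪ r.toFinset

/-- The transfer function `T(l, A)`. -/
def Fn.liveIn (f : Fn Reg) (l : Label) (A : Finset Reg) : Finset Reg :=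
  match f.code.get l with
  | some i => i.liveBefore A
  | none => ∅

def Fn.succs {ρ : Type} (f : Fn ρ) (l : Label) : List Label :=
  match f.code.get l with
  | some i => i.successors
  | none => []

/-- The sets `A(l)` of registers live after every program point `l`. -/
def analyze (N : ℕ) (f : Fn Reg) : Option (Label → Finset Reg) :=
  kildall f.code.nodes f.succs f.liveIn N

/-! ### The interference graph and its coloring -/

/-- Interferences between pseudo-registers, and between pseudo- and machine registers. -/
structure InterfGraph where
  regs : Finset (Sym2 Reg)
  mregs : Finset (Reg × MReg)

/-- Interferences between `r` and every register of `X`. -/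
def starEdges (r : Reg) (X : Finset Reg) : Finset (Sym2 Reg) := X.image fun r' => s(r, r')

/-- Interferences between pseudo-registers for an instruction, given the registers `A` live
after it. -/
def Instr.interf (A : Finset Reg) : Instr Reg → Finset (Sym2 Reg)
  | .op .move [rs] rd _ => starEdges rd (A \ {rs, rd})
  | .op _ _ r _ => starEdges r (A.erase r)
  | .load _ _ _ r _ => starEdges r (A.erase r)
  | .call _ _ _ r _ => starEdges r (A.erase r)
  | _ => ∅

/-- Interferences between the registers live across a call and the caller-save registers. -/
def Instr.interfCall (A : Finset Reg) : Instr Reg → Finset (Reg × MReg)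
  | .call _ _ _ r _ => A.erase r ×ˢ callerSave
  | _ => ∅

/-- The interference graph. Besides the instructions, function entry is a program point that
defines registers: every parameter interferes with all other registers live on entry. -/
def interfGraph (f : Fn Reg) (A : Label → Finset Reg) : InterfGraph where
  regs :=
    (f.code.nodes.biUnion fun l => ((f.code.get l).map (Instr.interf (A l))).getD ∅) ∪
      f.params.toFinset.biUnion fun p => starEdges p ((f.liveIn f.entry (A f.entry)).erase p)
  mregs := f.code.nodes.biUnion fun l => ((f.code.get l).map (Instr.interfCall (A l))).getD ∅

/-- Locations that the allocator may use: `local` slots and non-temporary registers. -/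
def Loc.Acceptable : Loc → Prop
  | .reg m => m.temporary = false
  | .slot (.local _ _) => True
  | .slot _ => False

/-- The properties that the validator checks. -/
structure ValidColoring (g : InterfGraph) (Γ : Reg → Ty) (Φ : Reg → Loc) : Prop where
  regs : ∀ r r', s(r, r') ∈ g.regs → Φ r ≠ Φ r'
  mregs : ∀ r m, (r, m) ∈ g.mregs → Φ r ≠ .reg m
  ty : ∀ r, (Φ r).ty = Γ r
  acceptable : ∀ r, (Φ r).Acceptable

/-- Untrusted coloring procedures. They may use the function, the results of liveness analysis
and typing (which determine the affinities), and the interference graph. -/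
abbrev Colorer :=
  Fn Reg → (Label → Finset Reg) → (Reg → Ty) → InterfGraph → Reg → Loc

open Classical in
/-- The coloring computed by the untrusted procedure `color`, after validation. -/
noncomputable def regalloc (color : Colorer) (f : Fn Reg) (A : Label → Finset Reg)
    (Γ : Reg → Ty) : Option (Reg → Loc) :=
  if ValidColoring (interfGraph f A) Γ (color f A Γ (interfGraph f A)) then
    some (color f A Γ (interfGraph f A))
  else none

/-! ### LTL generation -/

/-- Translation of an instruction, given the registers `A` live after it. Operators and loads
with a dead result and moves between identical locations become no-operations. -/
def transfInstr (Φ : Reg → Loc) (A : Finset Reg) : Instr Reg → Instr Loc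
  | .op .move [rs] rd l =>
      if rd ∈ A ∧ Φ rs ≠ Φ rd then .op .move [Φ rs] (Φ rd) l else .nop l
  | .op o args r l => if r ∈ A then .op o (args.map Φ) (Φ r) l else .nop l
  | .load κ m args r l => if r ∈ A then .load κ m (args.map Φ) (Φ r) l else .nop l
  | i => i.map Φ

/-- Rewriting of a function for a given liveness information and allocation. -/
def rewriteFn (f : Fn Reg) (A : Label → Finset Reg) (Φ : Reg → Loc) : Fn Loc where
  sig := f.sig
  params := f.params.map Φ
  stacksize := f.stacksize
  entry := f.entry
  code := f.code.rewrite fun l => transfInstr Φ (A l)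

/-- Register allocation for a function; `none` is a compile-time error. -/
noncomputable def transfFn (N : ℕ) (infer : Fn Reg → Reg → Ty) (color : Colorer) (f : Fn Reg) :
    Option (Fn Loc) :=
  (typecheck infer f).bind fun Γ =>
    (analyze N f).bind fun A =>
      (regalloc color f A Γ).map fun Φ => rewriteFn f A Φ

/-- Register allocation for a program. -/
noncomputable def transfProgram (N : ℕ) (infer : Fn Reg → Reg → Ty) (color : Colorer)
    (P : Program (Fn Reg)) : Option (Program (Fn Loc)) :=
  P.transf (transfFn N infer color)

/-! ### The invariant -/

/-- `Φ` is the allocation, and `A` the liveness information, used in the translation of `f`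
to `f'`. -/
structure Allocated (N : ℕ) (infer : Fn Reg → Reg → Ty) (color : Colorer) (f : Fn Reg)
    (f' : Fn Loc) (Γ : Reg → Ty) (A : Label → Finset Reg) (Φ : Reg → Loc) : Prop where
  transf : transfFn N infer color f = some f'
  typecheck : typecheck infer f = some Γ
  analyze : analyze N f = some A
  regalloc : regalloc color f A Γ = some Φ

/-- Agreement `R(r) = L(Φ(r))` for every register `r` live before the instruction at `l`. -/
def Agree (f : Fn Reg) (A : Label → Finset Reg) (Φ : Reg → Loc) (l : Label) (R : RTL.Regs)
    (L : LTL.LocMap) : Prop :=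
  ∀ r ∈ f.liveIn l (A l), R r = L (Φ r)

/-- The invariant between call stacks; `v` stands for the value that the pending call returns. -/
inductive MatchStacks (N : ℕ) (infer : Fn Reg → Reg → Ty) (color : Colorer) :
    List RTL.Frame → List LTL.Frame → Prop
  | nil : MatchStacks N infer color [] []
  | cons {stk stk' f f' Γ A Φ r σ l R L} :
      MatchStacks N infer color stk stk' →
      Allocated N infer color f f' Γ A Φ →
      (∀ v, Agree f A Φ l (Function.update R r v) (LTL.set L (Φ r) v)) →
      MatchStacks N infer color (⟨r, f.code, σ, l, R⟩ :: stk) (⟨Φ r, f', σ, l, L⟩ :: stk')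

/-- The invariant between RTL states and LTL states. -/
inductive MatchStates (N : ℕ) (infer : Fn Reg → Reg → Ty) (color : Colorer) :
    RTL.State → LTL.State → Prop
  | regular {stk stk' f f' Γ A Φ σ l R L M} :
      MatchStacks N infer color stk stk' →
      Allocated N infer color f f' Γ A Φ →
      Agree f A Φ l R L →
      MatchStates N infer color (.regular stk f.code σ l R M) (.regular stk' f' σ l L M)
  | call {stk stk' fd fd' vs M} :
      MatchStacks N infer color stk stk' →
      fd.transf (transfFn N infer color) = some fd' →
      MatchStates N infer color (.call stk fd vs M) (.call stk' fd' vs M)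
  | ret {stk stk' v M} :
      MatchStacks N infer color stk stk' →
      MatchStates N infer color (.ret stk v M) (.ret stk' v M)

end RegAlloc

open RegAlloc

/-!
Register allocation is correct because of the following commutation of assignments. Let `X` be
the set of registers live after a definition of `r`. If `R` and `L` agree on `X` without `r`, and
if `Φ` sends no other register of `X` to `Φ r`, then the state `R` with `r` set to `v` and the
state `L` with `Φ r` set to `v` agree on `X` (`update_eq_set`). Overlaps between stack slots play
no role, since the allocator only uses locations that overlap nothing but themselves. The
interferences checked by the validator provide the hypothesis on `Φ` at each instruction and, for
the parameters, at function entry (`initRegs_eq_initLocs`). At a move from `rs` to `rd` the edge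
between these two registers is missing, but then either `Φ rs ≠ Φ rd`, or the location of `rd`
already holds the right value (`Allocated.step_move`). At a call, the interferences with
caller-save registers show that the registers live across the call survive
(`Allocated.agree_postcall`).

Agreement on the registers live after `l` carries over to the registers live before each successor
of `l` because the result of Kildall's algorithm solves the dataflow inequations
(`liveIn_subset_of_analyze`). This needs neither termination nor monotonicity: the inequations
that are not known to hold are always those whose successor node is on the worklist
(`Worklist.Settled`), and a successful run ends with the worklist empty.

Translation leaves the symbols of the global environment unchanged and maps function definitions
blockwise (`Program.globalenv_translated`), so that operators, addressing modes and calls have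
corresponding results, and the lock-step simulation follows by cases on the RTL transition
(`MatchStates.step`). It lifts to transition sequences: for divergence, the LTL states related to
an RTL state that diverges with trace `T` form a relation of the kind that `Forever` asks for
(`Behaves.simulation`).
-/

namespace RegAlloc

/-! ### Soundness of the worklist algorithm -/

section Kildall

variable {α : Type} [SemilatticeSup α] [DecidableEq α] {nodes : Finset Label}
  {succs : Label → List Label} {T : Label → α → α}

/-- The invariant of the worklist algorithm: an inequation `T n (approx n) ≤ approx p` can only
fail if the successor `n` is still on the worklist. -/
def Worklist.Settled (nodes : Finset Label) (succs : Label → List Label) (T : Label → α → α)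
    (s : Worklist α) : Prop :=
  ∀ p ∈ nodes, ∀ n ∈ succs p, n ∈ nodes → n ∉ s.todo → T n (s.approx n) ≤ s.approx p

theorem Worklist.le_step (s : Worklist α) (n p : Label) :
    s.approx p ≤ (s.step nodes succs T n).approx p := by
  simp only [Worklist.step]
  split_ifs
  · exact le_sup_left
  · exact le_rfl

/-- `T` need not be monotone: a node whose approximation grows is put back on the worklist, so
for the nodes off the worklist the left-hand side of each inequation is unchanged. -/
theorem Worklist.Settled.step {s : Worklist α} (hs : s.Settled nodes succs T) (n : Label) :
    (s.step nodes succs T n).Settled nodes succs T := by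
  intro p hp m hm hmn hmt
  simp only [Worklist.step, Finset.mem_union, Finset.mem_erase, not_or, not_and] at hmt
  obtain ⟨hmt, hmc⟩ := hmt
  have hm_eq : (s.step nodes succs T n).approx m = s.approx m := if_neg hmc
  rw [hm_eq]
  by_cases hmn' : m = n
  · subst hmn'
    simp only [Worklist.step]
    split_ifs with hpc
    · exact le_sup_right
    · by_contra hle
      refine hpc (Finset.mem_filter.2 ⟨hp, hm, fun heq => hle ?_⟩)
      exact sup_eq_left.1 heq
  · exact (hs p hp m hm hmn (hmt hmn')).trans (s.le_step n p)

theorem Worklist.Settled.run {A : Label → α} :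
    ∀ {k : ℕ} {s : Worklist α}, s.Settled nodes succs T →
      Worklist.run nodes succs T k s = some A →
      ∀ p ∈ nodes, ∀ n ∈ succs p, n ∈ nodes → T n (A n) ≤ A p := by
  intro k
  induction k with
  | zero =>
    intro s hs hrun p hp n hn hnn
    unfold Worklist.run at hrun
    split_ifs at hrun with h
    cases hrun
    exact hs p hp n hn hnn fun hmem => h ⟨n, hmem⟩
  | succ k ih =>
    intro s hs hrun p hp n hn hnn
    unfold Worklist.run at hrun
    split_ifs at hrun with h
    · exact ih (hs.step _) hrun p hp n hn hnn
    · cases hrun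
      exact hs p hp n hn hnn fun hmem => h ⟨n, hmem⟩

end Kildall

/-- The result of liveness analysis solves the dataflow inequations. -/
theorem liveIn_subset_of_analyze {N : ℕ} {f : Fn Reg} {A : Label → Finset Reg}
    (hA : analyze N f = some A) {l s : Label} {i : Instr Reg} (hi : f.code.get l = some i)
    (hs : s ∈ i.successors) : f.liveIn s (A s) ⊆ A l := by
  by_cases hsn : s ∈ f.code.nodes
  · have hinit : Worklist.Settled f.code.nodes f.succs f.liveIn ⟨fun _ => ⊥, f.code.nodes⟩ :=
      fun p _ n _ hn hn' => absurd hn hn'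
    refine hinit.run hA l ?_ s ?_ hsn
    · rw [f.code.mem_nodes, hi]; rfl
    · simpa [Fn.succs, hi] using hs
  · have hget : f.code.get s = none := by
      simpa [f.code.mem_nodes] using hsn
    simp [Fn.liveIn, hget]

/-! ### Agreement and assignments -/

theorem Loc.Acceptable.overlap_eq_false {ℓ ℓ' : Loc} (h : ℓ.Acceptable) (hne : ℓ ≠ ℓ') :
    ℓ.overlap ℓ' = false := by
  rcases ℓ with m | ⟨τ, δ⟩ | ⟨τ, δ⟩ | ⟨τ, δ⟩ <;>
    rcases ℓ' with m' | ⟨τ', δ'⟩ | ⟨τ', δ'⟩ | ⟨τ', δ'⟩ <;>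
    simp_all [Loc.overlap, Loc.Acceptable]

theorem LTL.set_self (L : LTL.LocMap) (ℓ : Loc) (v : Val) : LTL.set L ℓ v ℓ = v :=
  if_pos rfl

theorem LTL.set_of_ne {L : LTL.LocMap} {ℓ ℓ' : Loc} (h : ℓ.Acceptable) (hne : ℓ ≠ ℓ') (v : Val) :
    LTL.set L ℓ v ℓ' = L ℓ' := by
  simp [LTL.set, hne, h.overlap_eq_false hne]

/-- Assigning the same value to `r` and to `Φ r` preserves agreement on `X` if no other register
of `X` shares the location of `r`. -/
theorem update_eq_set {Φ : Reg → Loc} {X : Finset Reg} {r : Reg} {R : RTL.Regs}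
    {L : LTL.LocMap} (hacc : (Φ r).Acceptable) (hne : ∀ r' ∈ X.erase r, Φ r ≠ Φ r')
    (hagree : ∀ r' ∈ X.erase r, R r' = L (Φ r')) (v : Val) :
    ∀ r' ∈ X, Function.update R r v r' = LTL.set L (Φ r) v (Φ r') := by
  intro r' hr'
  by_cases h : r' = r
  · subst h
    rw [Function.update_self, LTL.set_self]
  · have hmem := Finset.mem_erase.2 ⟨h, hr'⟩
    rw [Function.update_of_ne h, LTL.set_of_ne hacc (hne r' hmem), hagree r' hmem]

theorem LTL.postcall_eq {L : LTL.LocMap} {ℓ : Loc} (hacc : ℓ.Acceptable)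
    (hne : ∀ m ∈ callerSave, ℓ ≠ .reg m) : LTL.postcall L ℓ = L ℓ := by
  rcases ℓ with m | s
  · have hm : m.temporary = false := hacc
    have hm' : m ∉ callerSave := fun h => hne m h rfl
    simp [LTL.postcall, hm, hm']
  · rfl

theorem map_eq_of_agree {Φ : Reg → Loc} {R : RTL.Regs} {L : LTL.LocMap} {args : List Reg}
    (h : ∀ r ∈ args, R r = L (Φ r)) : (args.map Φ).map L = args.map R := by
  rw [List.map_map]
  exact List.map_congr_left fun r hr => (h r hr).symm

/-- Function entry: parameters are assigned from last to first, and each of them, live or not,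
avoids the locations of all other registers of `X`. Parameters may be repeated, and the number of
arguments may be wrong. -/
theorem initRegs_eq_initLocs {Φ : Reg → Loc} {X : Finset Reg} (hacc : ∀ r, (Φ r).Acceptable) :
    ∀ (ps : List Reg) (vs : List Val), (∀ p ∈ ps, ∀ r ∈ X.erase p, Φ p ≠ Φ r) →
      ∀ r ∈ X, RTL.initRegs ps vs r = LTL.initLocs (ps.map Φ) vs (Φ r)
  | [], _, _, _, _ => rfl
  | _ :: _, [], _, _, _ => rfl
  | p :: ps, v :: vs, hne, r, hr =>
    update_eq_set (hacc p) (hne p List.mem_cons_self)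
      (fun r' hr' => initRegs_eq_initLocs hacc ps vs
        (fun q hq => hne q (List.mem_cons_of_mem p hq)) r' (Finset.mem_of_mem_erase hr')) v r hr

/-! ### Consequences of a successful translation of a function -/

section Allocated

variable {N : ℕ} {infer : Fn Reg → Reg → Ty} {color : Colorer} {f : Fn Reg} {f' : Fn Loc}
  {Γ : Reg → Ty} {A : Label → Finset Reg} {Φ : Reg → Loc}

theorem Allocated.eq_rewriteFn (h : Allocated N infer color f f' Γ A Φ) :
    f' = rewriteFn f A Φ := by
  have ht := h.transf
  simp only [transfFn, h.typecheck, h.analyze, h.regalloc, Option.bind_some, Option.map_some,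
    Option.some.injEq] at ht
  exact ht.symm

theorem Allocated.validColoring (h : Allocated N infer color f f' Γ A Φ) :
    ValidColoring (interfGraph f A) Γ Φ := by
  have hr := h.regalloc
  unfold RegAlloc.regalloc at hr
  split_ifs at hr with hv
  cases hr
  exact hv

theorem exists_allocated (h : transfFn N infer color f = some f') :
    ∃ Γ A Φ, Allocated N infer color f f' Γ A Φ := by
  have h' := h
  simp only [transfFn, Option.bind_eq_some_iff, Option.map_eq_some_iff] at h'
  obtain ⟨Γ, hΓ, A, hA, Φ, hΦ, -⟩ := h'
  exact ⟨Γ, A, Φ, h, hΓ, hA, hΦ⟩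

theorem Allocated.get_code (h : Allocated N infer color f f' Γ A Φ) {l : Label} {i : Instr Reg}
    (hi : f.code.get l = some i) : f'.code.get l = some (transfInstr Φ (A l) i) := by
  simp [h.eq_rewriteFn, rewriteFn, CFG.rewrite, hi]

theorem Allocated.ne_of_interf (h : Allocated N infer color f f' Γ A Φ) {l : Label}
    {i : Instr Reg} (hi : f.code.get l = some i) {r r' : Reg} (he : s(r, r') ∈ i.interf (A l)) :
    Φ r ≠ Φ r' := by
  refine h.validColoring.regs r r' (Finset.mem_union_left _ (Finset.mem_biUnion.2 ⟨l, ?_, ?_⟩))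
  · rw [f.code.mem_nodes, hi]; rfl
  · simpa [hi] using he

theorem Allocated.ne_of_interfCall (h : Allocated N infer color f f' Γ A Φ) {l : Label}
    {i : Instr Reg} (hi : f.code.get l = some i) {r : Reg} {m : MReg}
    (he : (r, m) ∈ i.interfCall (A l)) : Φ r ≠ .reg m := by
  refine h.validColoring.mregs r m (Finset.mem_biUnion.2 ⟨l, ?_, ?_⟩)
  · rw [f.code.mem_nodes, hi]; rfl
  · simpa [hi] using he

theorem Allocated.ne_of_param (h : Allocated N infer color f f' Γ A Φ) {p r : Reg}
    (hp : p ∈ f.params) (hr : r ∈ (f.liveIn f.entry (A f.entry)).erase p) : Φ p ≠ Φ r :=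
  h.validColoring.regs p r (Finset.mem_union_right _ (Finset.mem_biUnion.2
    ⟨p, List.mem_toFinset.2 hp, Finset.mem_image_of_mem _ hr⟩))

theorem mem_starEdges {r r' : Reg} {X : Finset Reg} (h : r' ∈ X) : s(r, r') ∈ starEdges r X :=
  Finset.mem_image_of_mem _ h

/-- Agreement on the registers live after `l` gives agreement at every successor of `l`. -/
theorem Allocated.agree_of_liveOut (h : Allocated N infer color f f' Γ A Φ) {l l' : Label}
    {i : Instr Reg} (hi : f.code.get l = some i) (hl' : l' ∈ i.successors) {R : RTL.Regs}
    {L : LTL.LocMap} (hagree : ∀ r ∈ A l, R r = L (Φ r)) : Agree f A Φ l' R L :=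
  fun r hr => hagree r (liveIn_subset_of_analyze h.analyze hi hl' hr)

theorem Agree.liveBefore {l : Label} {R : RTL.Regs} {L : LTL.LocMap} (h : Agree f A Φ l R L)
    {i : Instr Reg} (hi : f.code.get l = some i) : ∀ r ∈ i.liveBefore (A l), R r = L (Φ r) := by
  simpa [Agree, Fn.liveIn, hi] using h

end Allocated

/-! ### Global environments -/

theorem evalOp_congr {F F' : Type} {G : GlobalEnv F} {G' : GlobalEnv F'}
    (h : G'.symbol = G.symbol) (σ : ℤ) (o : Operation) (vs : List Val) :
    evalOp G' σ o vs = evalOp G σ o vs := by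
  obtain ⟨s, g⟩ := G
  obtain ⟨s', g'⟩ := G'
  cases h
  rfl

theorem evalMode_congr {F F' : Type} {G : GlobalEnv F} {G' : GlobalEnv F'}
    (h : G'.symbol = G.symbol) (σ : ℤ) (m : Mode) (vs : List Val) :
    evalMode G' σ m vs = evalMode G σ m vs := by
  obtain ⟨s, g⟩ := G
  obtain ⟨s', g'⟩ := G'
  cases h
  rfl

/-- `G'` has the symbols of `G`, and the functions of `G` translated by `tr`. -/
structure GlobalEnv.Translated {F F' : Type} (tr : F → Option F') (G : GlobalEnv F)
    (G' : GlobalEnv F') : Prop where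
  symbol : G'.symbol = G.symbol
  funct : ∀ b fd, G.funct b = some fd → ∃ fd', fd.transf tr = some fd' ∧ G'.funct b = some fd'

theorem forall₂_of_mapM_eq_some {α β : Type} {f : α → Option β} :
    ∀ {as : List α} {bs : List β}, as.mapM f = some bs →
      List.Forall₂ (fun a b => f a = some b) as bs
  | [], bs, h => by
    cases (show some [] = some bs by simpa using h)
    exact .nil
  | a :: as, bs, h => by
    simp only [List.mapM_cons, Option.bind_eq_bind, Option.bind_eq_some_iff, Option.pure_def,
      Option.some.injEq] at h
    obtain ⟨b, hb, bs', hbs, rfl⟩ := h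
    exact .cons hb (forall₂_of_mapM_eq_some hbs)

theorem findIdx?_eq_of_forall₂ {α β : Type} {R : α → β → Prop} {p : α → Bool} {q : β → Bool}
    (hpq : ∀ a b, R a b → p a = q b) {as : List α} {bs : List β} (h : List.Forall₂ R as bs) :
    bs.findIdx? q = as.findIdx? p := by
  induction h with
  | nil => rfl
  | cons hab _ ih => simp [List.findIdx?_cons, hpq _ _ hab, ih]

theorem getElem?_of_forall₂ {α β : Type} {R : α → β → Prop} {as : List α} {bs : List β}
    (h : List.Forall₂ R as bs) :
    ∀ {n : ℕ} {a : α}, as[n]? = some a → ∃ b, bs[n]? = some b ∧ R a b := by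
  induction h with
  | nil => intro n a ha; simp at ha
  | cons hab _ ih =>
    intro n a ha
    cases n with
    | zero =>
      simp only [List.getElem?_cons_zero, Option.some.injEq] at ha ⊢
      exact ⟨_, rfl, ha ▸ hab⟩
    | succ n => simpa using ih (by simpa using ha)

theorem Program.transf_spec {F F' : Type} {tr : F → Option F'} {P : Program F} {P' : Program F'}
    (h : P.transf tr = some P') : P'.vars = P.vars ∧ P'.main = P.main ∧
      List.Forall₂ (fun d d' => d'.1 = d.1 ∧ d.2.transf tr = some d'.2) P.functs P'.functs := by
  simp only [Program.transf, Option.map_eq_some_iff] at h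
  obtain ⟨fs, hfs, rfl⟩ := h
  refine ⟨rfl, rfl, (forall₂_of_mapM_eq_some hfs).imp fun d d' hd => ?_⟩
  simp only [Option.map_eq_some_iff] at hd
  obtain ⟨fd, hfd, rfl⟩ := hd
  exact ⟨rfl, hfd⟩

theorem Program.globalenv_translated {F F' : Type} {tr : F → Option F'} {P : Program F}
    {P' : Program F'} (h : P.transf tr = some P') :
    GlobalEnv.Translated tr P.globalenv P'.globalenv := by
  obtain ⟨hvars, -, hfs⟩ := Program.transf_spec h
  constructor
  · funext id
    simp only [Program.globalenv, hvars]
    rw [findIdx?_eq_of_forall₂ (fun d d' hd => by rw [hd.1]) hfs]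
  · intro b fd hfd
    simp only [Program.globalenv] at hfd ⊢
    split_ifs at hfd ⊢
    obtain ⟨d, hd, rfl⟩ := Option.map_eq_some_iff.1 hfd
    obtain ⟨d', hd', -, ht⟩ := getElem?_of_forall₂ hfs hd
    exact ⟨d'.2, ht, by rw [hd']; rfl⟩

theorem Program.initmem_eq {F F' : Type} {P : Program F} {P' : Program F'}
    (h : P'.vars = P.vars) : P'.initmem = P.initmem := by
  simp only [Program.initmem, h]

theorem GlobalEnv.Translated.resolve {tr : Fn Reg → Option (Fn Loc)} {G : GlobalEnv (Fn Reg)}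
    {G' : GlobalEnv (Fn Loc)} (hG : G.Translated tr G') {Φ : Reg → Loc} {R : RTL.Regs}
    {L : LTL.LocMap} {c : Callee Reg} (hc : ∀ r ∈ c.regs, R r = L (Φ r)) {fd : FunDef (Fn Reg)}
    (h : RegAlloc.resolve G R c = some fd) :
    ∃ fd', fd.transf tr = some fd' ∧ RegAlloc.resolve G' L (c.map Φ) = some fd' := by
  cases c with
  | reg r =>
    have hr : R r = L (Φ r) := hc r (by simp [Callee.regs])
    simp only [RegAlloc.resolve, Callee.map, ← hr] at h ⊢
    cases hv : R r with
    | ptr b ofs =>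
      simp only [hv] at h ⊢
      split_ifs at h ⊢
      exact hG.funct b fd h
    | _ => simp [hv] at h
  | sym id =>
    simp only [RegAlloc.resolve, Callee.map, hG.symbol, Option.bind_eq_some_iff] at h ⊢
    obtain ⟨b, hb, hfd⟩ := h
    obtain ⟨fd', ht, hfd'⟩ := hG.funct b fd hfd
    exact ⟨fd', ht, b, hb, hfd'⟩

theorem sig_eq_of_transf {N : ℕ} {infer : Fn Reg → Reg → Ty} {color : Colorer}
    {fd : FunDef (Fn Reg)} {fd' : FunDef (Fn Loc)}
    (h : fd.transf (transfFn N infer color) = some fd') : fd'.sig = fd.sig := by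
  cases fd with
  | internal f =>
    obtain ⟨f', hf', rfl⟩ := Option.map_eq_some_iff.1 h
    obtain ⟨Γ, A, Φ, hall⟩ := exists_allocated hf'
    rw [hall.eq_rewriteFn]
    rfl
  | external e =>
    cases h
    rfl

/-! ### Lock-step simulation -/

section Simulation

variable {N : ℕ} {infer : Fn Reg → Reg → Ty} {color : Colorer} {f : Fn Reg} {f' : Fn Loc}
  {Γ : Reg → Ty} {A : Label → Finset Reg} {Φ : Reg → Loc}

/-- The common part of all instructions that define a register `r` and are not eliminated. -/
theorem Allocated.agree_update (h : Allocated N infer color f f' Γ A Φ) {l l' : Label}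
    {i : Instr Reg} (hi : f.code.get l = some i) (hl' : l' ∈ i.successors) {r : Reg}
    (hne : ∀ r' ∈ (A l).erase r, Φ r ≠ Φ r') {R : RTL.Regs} {L : LTL.LocMap}
    (hagree : ∀ r' ∈ (A l).erase r, R r' = L (Φ r')) (v : Val) :
    Agree f A Φ l' (Function.update R r v) (LTL.set L (Φ r) v) :=
  h.agree_of_liveOut hi hl' (update_eq_set (h.validColoring.acceptable r) hne hagree v)

theorem Allocated.agree_update_of_dead (h : Allocated N infer color f f' Γ A Φ) {l l' : Label}
    {i : Instr Reg} (hi : f.code.get l = some i) (hl' : l' ∈ i.successors) {r : Reg}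
    (hr : r ∉ A l) {R : RTL.Regs} {L : LTL.LocMap} (hagree : ∀ r' ∈ A l, R r' = L (Φ r'))
    (v : Val) : Agree f A Φ l' (Function.update R r v) L := by
  refine h.agree_of_liveOut hi hl' fun r' hr' => ?_
  rw [Function.update_of_ne (ne_of_mem_of_not_mem hr' hr)]
  exact hagree r' hr'

/-- The generic clause of the translation also applies to ill-formed moves, whose number of
arguments is not one. -/
theorem transfInstr_op {o : Operation} {args : List Reg} (h : ∀ rs, o = .move → args ≠ [rs])
    (X : Finset Reg) (r : Reg) (l : Label) :
    transfInstr Φ X (.op o args r l) = if r ∈ X then .op o (args.map Φ) (Φ r) l else .nop l := by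
  unfold transfInstr
  split <;> simp_all
  grind

theorem interf_op {o : Operation} {args : List Reg} (h : ∀ rs, o = .move → args ≠ [rs])
    (X : Finset Reg) (r : Reg) (l : Label) :
    (Instr.op o args r l).interf X = starEdges r (X.erase r) := by
  unfold Instr.interf
  split <;> simp_all
  grind

variable {G : GlobalEnv (Fn Reg)} {G' : GlobalEnv (Fn Loc)}

theorem Allocated.step_move (h : Allocated N infer color f f' Γ A Φ) {l l' : Label} {rs rd : Reg}
    (hi : f.code.get l = some (.op .move [rs] rd l')) {R : RTL.Regs} {L : LTL.LocMap}
    (hagree : Agree f A Φ l R L) (stk : List LTL.Frame) (σ : ℤ) (M : Mem) :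
    ∃ L', LTL.Step G' (.regular stk f' σ l L M) [] (.regular stk f' σ l' L' M) ∧
      Agree f A Φ l' (Function.update R rd (R rs)) L' := by
  have hcode := h.get_code hi
  have hlive := hagree.liveBefore hi
  simp only [Instr.liveBefore] at hlive
  by_cases hrd : rd ∈ A l
  · rw [if_pos hrd] at hlive
    have hrs : R rs = L (Φ rs) := hlive rs (by simp)
    have hrest : ∀ r' ∈ (A l).erase rd, R r' = L (Φ r') := fun r' hr' =>
      hlive r' (Finset.mem_union_left _ hr')
    by_cases hΦ : Φ rs = Φ rd
    · -- Coalescing: the location of `rd` already holds the value of `rs`.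
      refine ⟨L, .nop (by simpa [transfInstr, hΦ] using hcode),
        h.agree_of_liveOut hi (by simp [Instr.successors]) fun r' hr' => ?_⟩
      by_cases heq : r' = rd
      · rw [heq, Function.update_self, hrs, hΦ]
      · rw [Function.update_of_ne heq]
        exact hrest r' (Finset.mem_erase.2 ⟨heq, hr'⟩)
    · refine ⟨_, .op (v := R rs) (by simpa [transfInstr, hΦ, hrd] using hcode)
        (by simp [evalOp, hrs]),
        h.agree_update hi (by simp [Instr.successors]) (fun r' hr' => ?_) hrest _⟩
      -- The graph has no edge between `rs` and `rd`.
      by_cases heq : r' = rs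
      · exact heq ▸ Ne.symm hΦ
      · refine h.ne_of_interf hi (mem_starEdges ?_)
        rw [Finset.mem_erase] at hr'
        simp [hr'.1, hr'.2, heq]
  · rw [if_neg hrd] at hlive
    exact ⟨L, .nop (by simpa [transfInstr, hrd] using hcode),
      h.agree_update_of_dead hi (by simp [Instr.successors]) hrd hlive _⟩

theorem Allocated.step_op (h : Allocated N infer color f f' Γ A Φ)
    (hG : G'.symbol = G.symbol) {l l' : Label} {o : Operation} {args : List Reg} {r : Reg}
    (hi : f.code.get l = some (.op o args r l')) {R : RTL.Regs} {L : LTL.LocMap}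
    (hagree : Agree f A Φ l R L) {σ : ℤ} {v : Val} (hv : evalOp G σ o (args.map R) = some v)
    (stk : List LTL.Frame) (M : Mem) :
    ∃ L', LTL.Step G' (.regular stk f' σ l L M) [] (.regular stk f' σ l' L' M) ∧
      Agree f A Φ l' (Function.update R r v) L' := by
  by_cases hmove : ∃ rs, o = .move ∧ args = [rs]
  · obtain ⟨rs, rfl, rfl⟩ := hmove
    cases (show some (R rs) = some v from hv)
    exact h.step_move hi hagree stk σ M
  · have hmove' : ∀ rs, o = .move → args ≠ [rs] := fun rs ho ha => hmove ⟨rs, ho, ha⟩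
    have hcode := h.get_code hi
    rw [transfInstr_op hmove'] at hcode
    have hlive := hagree.liveBefore hi
    simp only [Instr.liveBefore] at hlive
    by_cases hr : r ∈ A l
    · rw [if_pos hr] at hcode hlive
      refine ⟨_, .op hcode (v := v) ?_, h.agree_update hi (by simp [Instr.successors])
        (fun r' hr' => h.ne_of_interf hi ?_)
        (fun r' hr' => hlive r' (Finset.mem_union_left _ hr')) _⟩
      · rw [map_eq_of_agree fun a ha => hlive a (Finset.mem_union_right _ (List.mem_toFinset.2 ha)),
          evalOp_congr hG, hv]
      · rw [interf_op hmove']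
        exact mem_starEdges hr'
    · rw [if_neg hr] at hcode hlive
      exact ⟨L, .nop hcode, h.agree_update_of_dead hi (by simp [Instr.successors]) hr hlive _⟩

theorem Allocated.step_load (h : Allocated N infer color f f' Γ A Φ)
    (hG : G'.symbol = G.symbol) {l l' : Label} {κ : Chunk} {m : Mode} {args : List Reg} {r : Reg}
    (hi : f.code.get l = some (.load κ m args r l')) {R : RTL.Regs} {L : LTL.LocMap}
    (hagree : Agree f A Φ l R L) {σ b : ℤ} {ofs : Word} {v : Val} {M : Mem}
    (haddr : evalMode G σ m (args.map R) = some (.ptr b ofs))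
    (hv : M.load κ b ofs.toInt = some v) (stk : List LTL.Frame) :
    ∃ L', LTL.Step G' (.regular stk f' σ l L M) [] (.regular stk f' σ l' L' M) ∧
      Agree f A Φ l' (Function.update R r v) L' := by
  have hcode := h.get_code hi
  have hlive := hagree.liveBefore hi
  simp only [Instr.liveBefore, transfInstr] at hlive hcode
  by_cases hr : r ∈ A l
  · rw [if_pos hr] at hcode hlive
    refine ⟨_, .load hcode ?_ hv, h.agree_update hi (by simp [Instr.successors])
      (fun r' hr' => h.ne_of_interf hi (mem_starEdges hr'))
      (fun r' hr' => hlive r' (Finset.mem_union_left _ hr')) _⟩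
    rw [map_eq_of_agree fun a ha => hlive a (Finset.mem_union_right _ (List.mem_toFinset.2 ha)),
      evalMode_congr hG, haddr]
  · rw [if_neg hr] at hcode hlive
    exact ⟨L, .nop hcode, h.agree_update_of_dead hi (by simp [Instr.successors]) hr hlive _⟩

/-- Registers live across a call are neither in temporary nor in caller-save registers, and none
of them shares the location of the result. -/
theorem Allocated.agree_postcall (h : Allocated N infer color f f' Γ A Φ) {l l' : Label}
    {sig : Signature} {c : Callee Reg} {args : List Reg} {r : Reg}
    (hi : f.code.get l = some (.call sig c args r l')) {R : RTL.Regs} {L : LTL.LocMap}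
    (hagree : ∀ r' ∈ (A l).erase r, R r' = L (Φ r')) (v : Val) :
    Agree f A Φ l' (Function.update R r v) (LTL.set (LTL.postcall L) (Φ r) v) := by
  refine h.agree_update hi (by simp [Instr.successors])
    (fun r' hr' => h.ne_of_interf hi (mem_starEdges hr')) (fun r' hr' => ?_) v
  rw [LTL.postcall_eq (h.validColoring.acceptable r') fun m hm =>
    h.ne_of_interfCall hi (Finset.mem_product.2 ⟨hr', hm⟩)]
  exact hagree r' hr'

theorem MatchStates.step (hG : G.Translated (transfFn N infer color) G') {S₁ S₁' : RTL.State}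
    {S₂ : LTL.State} {t : Trace} (hm : MatchStates N infer color S₁ S₂)
    (hstep : RTL.Step G S₁ t S₁') :
    ∃ S₂', LTL.Step G' S₂ t S₂' ∧ MatchStates N infer color S₁' S₂' := by
  cases hm with
  | regular hstk hall hagree =>
    cases hstep with
    | nop hi =>
      exact ⟨_, .nop (hall.get_code hi), .regular hstk hall
        (hall.agree_of_liveOut hi (by simp [Instr.successors]) (hagree.liveBefore hi))⟩
    | op hi hv =>
      obtain ⟨L', hs, ha⟩ := hall.step_op hG.symbol hi hagree hv _ _
      exact ⟨_, hs, .regular hstk hall ha⟩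
    | load hi haddr hv =>
      obtain ⟨L', hs, ha⟩ := hall.step_load hG.symbol hi hagree haddr hv _
      exact ⟨_, hs, .regular hstk hall ha⟩
    | @store _ _ _ _ _ _ _ _ args r _ b ofs _ hi haddr hst =>
      have hlive := hagree.liveBefore hi
      simp only [Instr.liveBefore] at hlive
      refine ⟨_, .store (b := b) (ofs := ofs) (hall.get_code hi) ?_ ?_, .regular hstk hall
        (hall.agree_of_liveOut hi (by simp [Instr.successors]) fun r' hr' =>
          hlive r' (by simp [hr']))⟩
      · rw [map_eq_of_agree fun a ha => hlive a (by simp [ha]), evalMode_congr hG.symbol, haddr]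
      · rw [← hlive r (by simp), hst]
    | call hi hfd hsig =>
      have hlive := hagree.liveBefore hi
      simp only [Instr.liveBefore] at hlive
      obtain ⟨fd', hfd', hres⟩ := hG.resolve (Φ := _) (fun a ha => hlive a (by simp [ha])) hfd
      refine ⟨_, .call (hall.get_code hi) hres ((sig_eq_of_transf hfd').trans hsig), ?_⟩
      rw [map_eq_of_agree fun a ha => hlive a (by simp [ha])]
      refine .call (.cons hstk hall ?_) hfd'
      exact hall.agree_postcall hi fun r' hr' =>
        hlive r' (Finset.mem_union_left _ (Finset.mem_union_left _ hr'))
    | tailcall hi hfd hsig =>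
      have hlive := hagree.liveBefore hi
      simp only [Instr.liveBefore] at hlive
      obtain ⟨fd', hfd', hres⟩ := hG.resolve (Φ := _) (fun a ha => hlive a (by simp [ha])) hfd
      refine ⟨_, .tailcall (hall.get_code hi) hres ((sig_eq_of_transf hfd').trans hsig), ?_⟩
      rw [map_eq_of_agree fun a ha => hlive a (by simp [ha])]
      exact .call hstk hfd'
    | condTrue hi hc =>
      have hlive := hagree.liveBefore hi
      simp only [Instr.liveBefore] at hlive
      refine ⟨_, .condTrue (hall.get_code hi) ?_, .regular hstk hall
        (hall.agree_of_liveOut hi (by simp [Instr.successors]) fun r' hr' =>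
          hlive r' (by simp [hr']))⟩
      rw [map_eq_of_agree fun a ha => hlive a (by simp [ha]), hc]
    | condFalse hi hc =>
      have hlive := hagree.liveBefore hi
      simp only [Instr.liveBefore] at hlive
      refine ⟨_, .condFalse (hall.get_code hi) ?_, .regular hstk hall
        (hall.agree_of_liveOut hi (by simp [Instr.successors]) fun r' hr' =>
          hlive r' (by simp [hr']))⟩
      rw [map_eq_of_agree fun a ha => hlive a (by simp [ha]), hc]
    | retVoid hi => exact ⟨_, .retVoid (hall.get_code hi), .ret hstk⟩
    | @retVal _ _ _ _ _ _ r hi =>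
      refine ⟨_, .retVal (hall.get_code hi), ?_⟩
      rw [← hagree.liveBefore hi r (by simp [Instr.liveBefore])]
      exact .ret hstk
  | call hstk hfd =>
    cases hstep with
    | @entry _ f vs M σ M' halloc =>
      obtain ⟨f', hf', rfl⟩ := Option.map_eq_some_iff.1 hfd
      obtain ⟨Γ, A, Φ, hall⟩ := exists_allocated hf'
      have heq := hall.eq_rewriteFn
      refine ⟨_, .entry (σ := σ) (M' := M') (by rw [heq]; exact halloc), ?_⟩
      have hentry : f'.entry = f.entry := by rw [heq]; rfl
      have hparams : f'.params = f.params.map Φ := by rw [heq]; rfl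
      rw [hentry, hparams]
      exact .regular hstk hall (initRegs_eq_initLocs hall.validColoring.acceptable _ _
        fun p hp r hr => hall.ne_of_param hp hr)
    | external hext =>
      cases hfd
      exact ⟨_, .external hext, .ret hstk⟩
  | ret hstk =>
    cases hstep with
    | resume =>
      cases hstk with
      | cons hstk hall hagree => exact ⟨_, .resume, .regular hstk hall (hagree _)⟩

theorem MatchStates.final {S₁ : RTL.State} {S₂ : LTL.State} {n : Word}
    (hm : MatchStates N infer color S₁ S₂) (hf : RTL.Final S₁ n) : LTL.Final S₂ n := by
  cases hf
  cases hm with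
  | ret hstk =>
    cases hstk
    exact .intro

/-! ### Initial states -/

variable {P : Program (Fn Reg)} {P' : Program (Fn Loc)}

theorem exists_initial (h : transfProgram N infer color P = some P') {S₁ : RTL.State}
    (hi : RTL.Initial P S₁) : ∃ S₂, LTL.Initial P' S₂ := by
  have hG := Program.globalenv_translated h
  obtain ⟨-, hmain, -⟩ := Program.transf_spec h
  obtain ⟨hb, hfd⟩ := hi
  obtain ⟨fd', -, hfd'⟩ := hG.funct _ _ hfd
  exact ⟨_, .intro (by rw [hG.symbol, hmain, hb]) hfd'⟩

theorem matchStates_initial (h : transfProgram N infer color P = some P') {S₁ : RTL.State}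
    {S₂ : LTL.State} (hi₁ : RTL.Initial P S₁) (hi₂ : LTL.Initial P' S₂) :
    MatchStates N infer color S₁ S₂ := by
  have hG := Program.globalenv_translated h
  obtain ⟨hvars, hmain, -⟩ := Program.transf_spec h
  obtain ⟨hb, hfd⟩ := hi₁
  obtain ⟨hb', hfd'⟩ := hi₂
  rw [hG.symbol, hmain, hb] at hb'
  cases hb'
  obtain ⟨fd', ht, hfd''⟩ := hG.funct _ _ hfd
  rw [hfd'] at hfd''
  cases hfd''
  rw [Program.initmem_eq hvars]
  exact .call .nil ht

end Simulation

/-! ### From lock-step simulation to behaviors -/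

section Behaviors

variable {S₁ S₂ : Type} {step₁ : S₁ → Trace → S₁ → Prop} {step₂ : S₂ → Trace → S₂ → Prop}
  {rel : S₁ → S₂ → Prop}

theorem Star.simulation
    (hsim : ∀ s₁ s₂ t s₁', rel s₁ s₂ → step₁ s₁ t s₁' → ∃ s₂', step₂ s₂ t s₂' ∧ rel s₁' s₂')
    {s₁ s₁' : S₁} {t : Trace} (h : Star step₁ s₁ t s₁') :
    ∀ {s₂ : S₂}, rel s₁ s₂ → ∃ s₂', Star step₂ s₂ t s₂' ∧ rel s₁' s₂' := by
  induction h with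
  | refl s => exact fun hrel => ⟨_, .refl _, hrel⟩
  | step hstep _ ih =>
    intro s₂ hrel
    obtain ⟨s₂', hs, hrel'⟩ := hsim _ _ _ _ hrel hstep
    obtain ⟨s₂'', hs', hrel''⟩ := ih hrel'
    exact ⟨s₂'', .step hs hs', hrel''⟩

theorem Forever.simulation
    (hsim : ∀ s₁ s₂ t s₁', rel s₁ s₂ → step₁ s₁ t s₁' → ∃ s₂', step₂ s₂ t s₂' ∧ rel s₁' s₂')
    {s₁ : S₁} {s₂ : S₂} {T : Stream'.Seq Event} (hrel : rel s₁ s₂) (h : Forever step₁ s₁ T) :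
    Forever step₂ s₂ T := by
  obtain ⟨X, hX, hstep⟩ := h
  refine ⟨fun s₂ T => ∃ s₁, rel s₁ s₂ ∧ X s₁ T, ⟨s₁, hrel, hX⟩, ?_⟩
  rintro s₂ T ⟨s₁, hrel, hX⟩
  obtain ⟨t, s₁', T', hs, hX', rfl⟩ := hstep s₁ T hX
  obtain ⟨s₂', hs', hrel'⟩ := hsim _ _ _ _ hrel hs
  exact ⟨t, s₂', T', hs', ⟨s₁', hrel', hX'⟩, rfl⟩

theorem Behaves.simulation {initial₁ : S₁ → Prop} {initial₂ : S₂ → Prop}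
    {final₁ : S₁ → Word → Prop} {final₂ : S₂ → Word → Prop}
    (hinit : ∀ s₁, initial₁ s₁ → ∃ s₂, initial₂ s₂ ∧ rel s₁ s₂)
    (hfinal : ∀ s₁ s₂ n, rel s₁ s₂ → final₁ s₁ n → final₂ s₂ n)
    (hsim : ∀ s₁ s₂ t s₁', rel s₁ s₂ → step₁ s₁ t s₁' → ∃ s₂', step₂ s₂ t s₂' ∧ rel s₁' s₂')
    {B : Behavior} (hB : ¬ B.Wrong) (h : Behaves step₁ initial₁ final₁ B) :
    Behaves step₂ initial₂ final₂ B := by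
  cases h with
  | converges hi hs hf =>
    obtain ⟨s₂, hi₂, hrel⟩ := hinit _ hi
    obtain ⟨s₂', hs₂, hrel'⟩ := hs.simulation hsim hrel
    exact .converges hi₂ hs₂ (hfinal _ _ _ hrel' hf)
  | diverges hi hs =>
    obtain ⟨s₂, hi₂, hrel⟩ := hinit _ hi
    exact .diverges hi₂ (hs.simulation hsim hrel)
  | goeswrong => exact absurd trivial hB

end Behaviors

end RegAlloc

/-- Register allocation from RTL to LTL preserves semantics, by a lock-step simulation. -/
theorem mainTheorem6 (N : ℕ) (infer : Fn Reg → Reg → Ty) (color : Colorer)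
    (P : Program (Fn Reg)) (P' : Program (Fn Loc))
    (hP : transfProgram N infer color P = some P') :
    (∀ S₁, RTL.Initial P S₁ → ∃ S₂, LTL.Initial P' S₂) ∧
    (∀ S₁ S₂, RTL.Initial P S₁ → LTL.Initial P' S₂ → MatchStates N infer color S₁ S₂) ∧
    (∀ S₁ S₂ n, MatchStates N infer color S₁ S₂ → RTL.Final S₁ n → LTL.Final S₂ n) ∧
    (∀ S₁ S₂ t S₁', MatchStates N infer color S₁ S₂ → RTL.Step P.globalenv S₁ t S₁' →
      ∃ S₂', LTL.Step P'.globalenv S₂ t S₂' ∧ MatchStates N infer color S₁' S₂') ∧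
    (∀ B : Behavior, ¬ B.Wrong → RTL.ProgBehaves P B → LTL.ProgBehaves P' B) := by
  have hG := Program.globalenv_translated hP
  refine ⟨fun _ => exists_initial hP, fun _ _ => matchStates_initial hP,
    fun _ _ _ => MatchStates.final, fun _ _ _ _ => MatchStates.step hG, fun B hB => ?_⟩
  refine Behaves.simulation (rel := MatchStates N infer color) (step₁ := RTL.Step P.globalenv)
    (step₂ := LTL.Step P'.globalenv) (final₁ := RTL.Final) (final₂ := LTL.Final) (fun S₁ hS₁ => ?_)
    (fun _ _ _ => MatchStates.final) (fun _ _ _ _ => MatchStates.step hG) hB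
  obtain ⟨S₂, hS₂⟩ := exists_initial hP hS₁
  exact ⟨S₂, hS₂, matchStates_initial hP hS₁ hS₂⟩
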